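/- For a nonnegative Borel measure $\mu$ on $[0,\infty)$ and $\rho\in\mathbb R$ put $$\|\mu\|_\rho=\sup_{R>1}\frac{1}{(1+R)^{\rho}}\,\frac1R\,\mu([R/2,R])+\mu([0,1]),$$ and let $\mathcal M^\rho_+$ be the set of $\mu$ with $\|\mu\|_\rho<\infty$. For $\alpha\ge 0$ and $\varepsilon>0$ put $$N_\alpha(\mu,\varepsilon)=\varepsilon^{-\alpha}\int_{[0,\varepsilon]}\Big(1-\frac x\varepsilon\Big)^2d\mu(x),\qquad \underline N_\alpha(\mu)=\lim_{\varepsilon\to0^+}\ \inf_{0<\delta\le\varepsilon}N_\alpha(\mu,\delta),\qquad \overline N_\alpha(\mu)=\lim_{\varepsilon\to0^+}\ \sup_{0<\delta\le\varepsilon}N_\alpha(\mu,\delta),$$ with values in $[0,\infty]$. Let $\rho<-1$ and $g_0\in\mathcal M^\rho_+$. A family $(g(t))_{t\ge0}$ of measures in $\mathcal M^\rho_+$ with $g(0)=g_0$ is called a (nonnegative) weak solution of the radial Schrödinger wave kinetic equation (written for $g=\sqrt\omega f$) with initial datum $g_0$ if $t\mapsto g(t)$ is weakly continuous on $[0,\infty)$,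 that is, $t\mapsto\int\psi\,dg(t)$ is continuous for every $\psi\in C_c([0,\infty))$, and if for every compactly supported $\varphi\in C^2([0,\infty)\times[0,\infty))$ and every $T>0$ $$\int\varphi(T,\omega)\,dg(T)(\omega)-\int\varphi(0,\omega)\,dg_0(\omega)=\int_0^T\!\!\int\partial_t\varphi(t,\omega)\,dg(t)(\omega)\,dt$$ $$+\int_0^T\!\!\iiint_{[0,\infty)^3}\frac{\Phi}{\sqrt{\omega_1\omega_2\omega_3}}\big[\varphi(t,\omega_4)+\varphi(t,\omega_3)-\varphi(t,\omega_1)-\varphi(t,\omega_2)\big]\,dg(t)(\omega_1)\,dg(t)(\omega_2)\,dg(t)(\omega_3)\,dt,$$ where $\omega_4=\omega_1+\omega_2-\omega_3$, $\Phi=\min\{\sqrt{\omega_1},\sqrt{\omega_2},\sqrt{\omega_3},\sqrt{(\omega_4)_+}\}$ (so the integrand is $0$ if $\omega_4<0$), and the integrand is extended by continuity from $(0,\infty)^3$ to $[0,\infty)^3$. It conserves mass and energy if $\int dg(t)=\int dg_0$ and $\int\omega\,dg(t)(\omega)=\int\omega\,dg_0(\omega)$ (in $[0,\infty]$) for all $t>0$.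 **Proposition.** There is a numerical constant $C>0$ such that for all $\rho<-1$, all $g_0\in\mathcal M^\rho_+$ and every weak solution $g$ with initial datum $g_0$ that conserves mass and energy, $$g(t)(\{0\})>0\qquad\text{for all } t>t_*:=C\big(\underline N_{1/2}(g_0)\,\overline N_{1/2}(g_0)\big)^{-1},$$ where $t_*=\infty$ (no claim) if $\underline N_{1/2}(g_0)=0$, and $t_*=0$ if $\underline N_{1/2}(g_0)>0$ and $\overline N_{1/2}(g_0)=\infty$. -/

import Mathlib

open MeasureTheory Set Filter Topology
open scoped NNReal ENNReal

namespace WaveKinetic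

noncomputable section

/-- The size `‖μ‖_ρ` of a nonnegative measure on `[0, ∞)`:
`sup_{R > 1} (1 + R)^(-ρ) R⁻¹ μ([R/2, R]) + μ([0, 1])`. -/
def rhoNorm (ρ : ℝ) (μ : Measure ℝ≥0) : ℝ≥0∞ :=
  (⨆ (R : ℝ≥0) (_ : 1 < R),
    ENNReal.ofReal ((1 + (R : ℝ)) ^ (-ρ) * (R : ℝ)⁻¹) * μ (Icc (R / 2) R)) + μ (Icc 0 1)

/-- `Φ / √(ω₁ω₂ω₃)` with `Φ = min {√ω₁, √ω₂, √ω₃, √ω₄}`, `ω₄ = ω₁ + ω₂ - ω₃` (and `√ω₄ = 0` if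
`ω₄ ≤ 0`), with the smallest factor cancelled. On `(0, ∞)³` this is literally that quotient, see
`collisionKernel_eq`. Where some `ωᵢ` vanishes the quotient reads `0 / 0`; the form below
makes `collisionIntegrand φ` on `[0, ∞)³` the extension by continuity of its values on
`(0, ∞)³`, so that a possible atom of the measure at `0` takes part in the interaction. -/
def collisionKernel (ω₁ ω₂ ω₃ : ℝ) : ℝ :=
  if ω₃ ≤ max ω₁ ω₂ then 1 / √(max (ω₁ * ω₂) (max (ω₁ * ω₃) (ω₂ * ω₃)))
  else √(ω₁ + ω₂ - ω₃) / √(ω₁ * ω₂ * ω₃)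

theorem collisionKernel_eq {ω₁ ω₂ ω₃ : ℝ} (h₁ : 0 < ω₁) (h₂ : 0 < ω₂) (h₃ : 0 < ω₃) :
    collisionKernel ω₁ ω₂ ω₃ =
      min (min √ω₁ √ω₂) (min √ω₃ √(ω₁ + ω₂ - ω₃)) / √(ω₁ * ω₂ * ω₃) := by
  have hd : √(ω₁ * ω₂ * ω₃) = √ω₁ * √ω₂ * √ω₃ := by
    rw [Real.sqrt_mul (by positivity), Real.sqrt_mul h₁.le]
  have p₁ := Real.sqrt_pos.2 h₁
  have p₂ := Real.sqrt_pos.2 h₂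
  have p₃ := Real.sqrt_pos.2 h₃
  unfold collisionKernel
  split_ifs with h
  · have key : ∀ a b c : ℝ, 0 < a → a ≤ b → a ≤ c →
        max (a * b) (max (a * c) (b * c)) = b * c := fun a b c ha hb hc => by
      rw [max_eq_right (b := b * c) (by nlinarith), max_eq_right (by nlinarith)]
    rcases le_total ω₁ ω₂ with h12 | h12
    · rw [max_eq_right h12] at h
      rcases le_total ω₁ ω₃ with h13 | h13
      · rw [key ω₁ ω₂ ω₃ h₁ h12 h13, min_eq_left (Real.sqrt_le_sqrt h12), min_eq_left
          (le_min (Real.sqrt_le_sqrt h13) (Real.sqrt_le_sqrt (by linarith))), hd,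
          Real.sqrt_mul h₂.le]
        field_simp
      · have := key ω₃ ω₁ ω₂ h₃ h13 h
        rw [show max (ω₁ * ω₂) (max (ω₁ * ω₃) (ω₂ * ω₃)) = ω₁ * ω₂ by
          rw [← this, mul_comm ω₃, mul_comm ω₃]; grind,
          min_eq_left (a := √ω₃) (Real.sqrt_le_sqrt (by linarith)), min_eq_right
          (le_min (Real.sqrt_le_sqrt h13) (Real.sqrt_le_sqrt h)), hd, Real.sqrt_mul h₁.le]
        field_simp
    · rw [max_eq_left h12] at h
      rcases le_total ω₂ ω₃ with h23 | h23
      · have := key ω₂ ω₁ ω₃ h₂ h12 h23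
        rw [show max (ω₁ * ω₂) (max (ω₁ * ω₃) (ω₂ * ω₃)) = ω₁ * ω₃ by
          rw [← this, mul_comm ω₂]; grind,
          min_eq_right (Real.sqrt_le_sqrt h12), min_eq_left
          (le_min (Real.sqrt_le_sqrt h23) (Real.sqrt_le_sqrt (by linarith))), hd,
          Real.sqrt_mul h₁.le]
        field_simp
      · have := key ω₃ ω₁ ω₂ h₃ h h23
        rw [show max (ω₁ * ω₂) (max (ω₁ * ω₃) (ω₂ * ω₃)) = ω₁ * ω₂ by
          rw [← this, mul_comm ω₃, mul_comm ω₃]; grind,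
          min_eq_left (a := √ω₃) (Real.sqrt_le_sqrt (by linarith)), min_eq_right
          (le_min (Real.sqrt_le_sqrt h) (Real.sqrt_le_sqrt h23)), hd, Real.sqrt_mul h₁.le]
        field_simp
  · rw [not_le, max_lt_iff] at h
    rw [min_eq_right (a := √ω₃) (Real.sqrt_le_sqrt (by linarith [h.1])), min_eq_right
      (le_min (Real.sqrt_le_sqrt (by linarith [h.2])) (Real.sqrt_le_sqrt (by linarith [h.1])))]

/-- The integrand of the collision integral against a test function `φ`. -/
def collisionIntegrand (φ : ℝ → ℝ) (ω₁ ω₂ ω₃ : ℝ) : ℝ :=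
  collisionKernel ω₁ ω₂ ω₃ * (φ (ω₁ + ω₂ - ω₃) + φ ω₃ - φ ω₁ - φ ω₂)

/-- The collision integral of the measure `μ` against `φ`, over `[0, ∞)³`. -/
def collision (φ : ℝ → ℝ) (μ : Measure ℝ≥0) : ℝ :=
  ∫ p : ℝ≥0 × ℝ≥0 × ℝ≥0, collisionIntegrand φ p.1 p.2.1 p.2.2 ∂(μ.prod (μ.prod μ))

/-- `g` (that is `g(t, ω) = √ω f(t, ω)`, as a family of measures on `[0, ∞)`) is a weak solution
with initial datum `g₀`. Only the values `g t` with `0 ≤ t` matter. Continuity in time is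
continuity for the weak topology of measures. -/
structure IsWeakSolution (ρ : ℝ) (g₀ : Measure ℝ≥0) (g : ℝ → Measure ℝ≥0) : Prop where
  initial : g 0 = g₀
  rhoNorm_lt_top : ∀ t, 0 ≤ t → rhoNorm ρ (g t) < ∞
  continuousOn : ∀ ψ : ℝ≥0 → ℝ, Continuous ψ → HasCompactSupport ψ →
    ContinuousOn (fun t => ∫ ω, ψ ω ∂(g t)) (Ici 0)
  weak_eq : ∀ φ : ℝ → ℝ → ℝ, ContDiff ℝ 2 (Function.uncurry φ) →
    HasCompactSupport (Function.uncurry φ) → ∀ T : ℝ, 0 < T →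
      ∫ ω : ℝ≥0, φ T ω ∂(g T) - ∫ ω : ℝ≥0, φ 0 ω ∂g₀ =
        (∫ t in (0 : ℝ)..T, ∫ ω : ℝ≥0, deriv (fun s => φ s ω) t ∂(g t)) +
          ∫ t in (0 : ℝ)..T, collision (φ t) (g t)

/-- Conservation of mass and energy, as identities in `[0, ∞]`. -/
structure ConservesMassEnergy (g₀ : Measure ℝ≥0) (g : ℝ → Measure ℝ≥0) : Prop where
  mass : ∀ t, 0 < t → g t univ = g₀ univ
  energy : ∀ t, 0 < t → ∫⁻ ω : ℝ≥0, (ω : ℝ≥0∞) ∂(g t) = ∫⁻ ω : ℝ≥0, (ω : ℝ≥0∞) ∂g₀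

/-- `N_α(g, ε) = ε^(-α) ∫_{[0, ε]} (1 - x/ε)² dg(x)`. -/
def N (α : ℝ) (g : Measure ℝ≥0) (ε : ℝ) : ℝ≥0∞ :=
  ENNReal.ofReal (ε ^ (-α)) *
    ∫⁻ x in {x : ℝ≥0 | (x : ℝ) ≤ ε}, ENNReal.ofReal ((1 - (x : ℝ) / ε) ^ 2) ∂g

/-- `inf_{0 < δ ≤ ε} N_α(g, δ)`. -/
def lowerNAt (α : ℝ) (g : Measure ℝ≥0) (ε : ℝ) : ℝ≥0∞ := ⨅ δ ∈ Ioc 0 ε, N α g δ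

/-- `sup_{0 < δ ≤ ε} N_α(g, δ)`. -/
def upperNAt (α : ℝ) (g : Measure ℝ≥0) (ε : ℝ) : ℝ≥0∞ := ⨆ δ ∈ Ioc 0 ε, N α g δ

/-- The limit of `lowerNAt α g ε` as `ε → 0+`, see `tendsto_lowerNAt`. -/
def lowerN (α : ℝ) (g : Measure ℝ≥0) : ℝ≥0∞ := ⨆ ε ∈ Ioi (0 : ℝ), lowerNAt α g ε

/-- The limit of `upperNAt α g ε` as `ε → 0+`, see `tendsto_upperNAt`. -/
def upperN (α : ℝ) (g : Measure ℝ≥0) : ℝ≥0∞ := ⨅ ε ∈ Ioi (0 : ℝ), upperNAt α g ε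

theorem tendsto_lowerNAt (α : ℝ) (g : Measure ℝ≥0) :
    Tendsto (lowerNAt α g) (𝓝[>] 0) (𝓝 (lowerN α g)) := by
  have h : Antitone (lowerNAt α g) := fun a b hab =>
    biInf_mono fun δ hδ => ⟨hδ.1, hδ.2.trans hab⟩
  have := h.tendsto_nhdsGT 0
  rwa [sSup_image] at this

theorem tendsto_upperNAt (α : ℝ) (g : Measure ℝ≥0) :
    Tendsto (upperNAt α g) (𝓝[>] 0) (𝓝 (upperN α g)) := by
  have h : Monotone (upperNAt α g) := fun a b hab =>
    biSup_mono fun δ hδ => ⟨hδ.1, hδ.2.trans hab⟩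
  have := h.tendsto_nhdsGT 0
  rwa [sInf_image] at this

end

end WaveKinetic

/-!
Test the equation against convex cutoffs `bump r` of `[0, r]`. Averaged over the three choices of
the outgoing frequency, the collision integrand of a convex function is nonnegative, so mass never
escapes from a neighbourhood of zero: `μ_s([0, r]) ≤ 8 μ_t([0, 2r])` for `s ≤ t`. Moreover, the
interaction of the mass in `[0, r/8]` with the shell `(r/4, r]` makes `∫ bump r` grow at a rate of
at least `μ([0, r/8]) μ((r/4, r])² / (1536 r)`. The lower bound on `N_{1/2}` provides mass of order
`r^{1/2}` in every `[0, r/8]` at all times. If there is no atom at zero at time `T`, the shells at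
the scales `R/4^k` carry a fixed fraction of the mass of `[0, R]` up to time `T`, and a weighted sum
of these growth estimates becomes `F' ≥ A F²`. Hence `T` is at most the blow-up time of order
`1 / (A F(0))`.
-/

namespace WaveKinetic

noncomputable section

theorem hasDerivAt_max_zero_pow (n : ℕ) (x : ℝ) :
    HasDerivAt (fun y : ℝ => max y 0 ^ (n + 2)) ((n + 2) * max x 0 ^ (n + 1)) x := by
  rcases lt_trichotomy x 0 with hx | rfl | hx
  · have : (fun y : ℝ => max y 0 ^ (n + 2)) =ᶠ[𝓝 x] fun _ => 0 := by
      filter_upwards [Iio_mem_nhds hx] with y hy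
      rw [max_eq_right (le_of_lt hy), zero_pow (by lia)]
    rw [max_eq_right hx.le]
    simpa using (hasDerivAt_const x (0 : ℝ)).congr_of_eventuallyEq this
  · have hO : (fun y : ℝ => max y 0 ^ (n + 2)) =O[𝓝 0] fun y : ℝ => y ^ (n + 2) := by
      refine .of_bound 1 (.of_forall fun y => ?_)
      rw [one_mul, norm_pow, norm_pow, Real.norm_of_nonneg (le_max_right _ _)]
      exact pow_le_pow_left₀ (le_max_right _ _) (max_le (le_abs_self y) (abs_nonneg y)) _
    rw [hasDerivAt_iff_isLittleO]
    simpa using hO.trans_isLittleO (Asymptotics.isLittleO_pow_pow (𝕜 := ℝ) (by lia : 1 < n + 2))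
  · have : (fun y : ℝ => max y 0 ^ (n + 2)) =ᶠ[𝓝 x] fun y => y ^ (n + 2) := by
      filter_upwards [Ioi_mem_nhds hx] with y hy
      rw [max_eq_left (le_of_lt hy)]
    rw [max_eq_left hx.le]
    simpa using (hasDerivAt_pow (n + 2) x).congr_of_eventuallyEq this

theorem contDiff_max_zero_pow (n : ℕ) : ContDiff ℝ n fun x : ℝ => max x 0 ^ (n + 1) := by
  induction n with
  | zero => exact contDiff_zero.2 (by fun_prop)
  | succ n ih =>
    rw [Nat.cast_succ, contDiff_succ_iff_deriv,
      show deriv (fun x : ℝ => max x 0 ^ (n + 2)) = fun x : ℝ => (n + 2) * max x 0 ^ (n + 1) from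
        funext fun x => (hasDerivAt_max_zero_pow n x).deriv]
    exact ⟨fun x => (hasDerivAt_max_zero_pow n x).differentiableAt, by simp,
      contDiff_const.mul ih⟩

theorem map_add_sub_add_map_le_of_convexOn {𝕜 E β : Type*} [Semiring 𝕜] [PartialOrder 𝕜]
    [AddCommGroup E] [AddCommMonoid β] [PartialOrder β] [IsOrderedAddMonoid β] [Module 𝕜 E]
    [Module 𝕜 β] {s : Set E} {f : E → β} (hf : ConvexOn 𝕜 s f) {x y z : E} (hx : x ∈ s)
    (hz : z ∈ s) (hy : y ∈ segment 𝕜 x z) : f (x + z - y) + f y ≤ f x + f z := by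
  obtain ⟨a, b, ha, hb, hab, rfl⟩ := hy
  have hreflect : x + z - (a • x + b • z) = b • x + a • z := by
    rw [sub_eq_iff_eq_add]
    calc x + z = (a + b) • x + (a + b) • z := by rw [hab, one_smul, one_smul]
      _ = b • x + a • z + (a • x + b • z) := by simp only [add_smul]; abel
  calc f (x + z - (a • x + b • z)) + f (a • x + b • z)
      ≤ (b • f x + a • f z) + (a • f x + b • f z) := by
        rw [hreflect]
        exact add_le_add (hf.2 hx hz hb ha (by rw [add_comm, hab])) (hf.2 hx hz ha hb hab)
    _ = (a + b) • f x + (a + b) • f z := by simp only [add_smul]; abel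
    _ = f x + f z := by rw [hab, one_smul, one_smul]

theorem norm_four_point_le_of_lipschitzWith_fderiv {E F : Type*} [NormedAddCommGroup E]
    [NormedSpace ℝ E] [NormedAddCommGroup F] [NormedSpace ℝ F] {f : E → F} {L : ℝ≥0}
    (hf : Differentiable ℝ f) (hL : LipschitzWith L (fderiv ℝ f)) (x h k : E) :
    ‖f (x + h + k) + f x - f (x + h) - f (x + k)‖ ≤ L * ‖h‖ * ‖k‖ := by
  have hderiv : ∀ y, HasFDerivAt (fun y => f (y + h) - f y)
      (fderiv ℝ f (y + h) - fderiv ℝ f y) y := fun y =>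
    ((hasFDerivAt_comp_add_right h).2 (hf (y + h)).hasFDerivAt).sub (hf y).hasFDerivAt
  have hbound : ∀ y, ‖fderiv ℝ f (y + h) - fderiv ℝ f y‖ ≤ L * ‖h‖ := fun y => by
    simpa [dist_eq_norm] using hL.dist_le_mul (y + h) y
  have key := convex_univ.norm_image_sub_le_of_norm_hasFDerivWithin_le
    (fun y _ => (hderiv y).hasFDerivWithinAt) (fun y _ => hbound y) (mem_univ x) (mem_univ (x + k))
  rw [add_sub_cancel_left, add_right_comm x k h] at key
  convert key using 2
  abel

/-- Functions on `[0, ∞)` that extend to compactly supported `C²` functions on the line; their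
values on the negative half-line are immaterial. -/
def testFunctions : Submodule ℝ (ℝ → ℝ) where
  carrier := {f | ∃ ψ : ℝ → ℝ, ContDiff ℝ 2 ψ ∧ HasCompactSupport ψ ∧ EqOn ψ f (Ici 0)}
  zero_mem' := ⟨0, contDiff_const, .zero, fun _ _ => rfl⟩
  add_mem' := by
    rintro f h ⟨ψ, hψ, hψc, hψf⟩ ⟨χ, hχ, hχc, hχh⟩
    exact ⟨ψ + χ, hψ.add hχ, hψc.add hχc, fun x hx => congrArg₂ (· + ·) (hψf hx) (hχh hx)⟩
  smul_mem' := by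
    rintro c f ⟨ψ, hψ, hψc, hψf⟩
    exact ⟨c • ψ, contDiff_const.smul hψ, hψc.smul_left, fun x hx => congrArg (c • ·) (hψf hx)⟩

theorem integrable_of_mem_testFunctions {f : ℝ → ℝ} (hf : f ∈ testFunctions) (μ : Measure ℝ≥0)
    [IsFiniteMeasure μ] : Integrable (fun x : ℝ≥0 => f x) μ := by
  obtain ⟨ψ, hψ, hψc, hψf⟩ := hf
  obtain ⟨M, hM⟩ := hψc.exists_bound_of_continuous hψ.continuous
  simp_rw [← fun x : ℝ≥0 => hψf (mem_Ici.2 x.coe_nonneg)]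
  exact .of_bound (hψ.continuous.comp NNReal.continuous_coe).aestronglyMeasurable M
    (.of_forall fun x => hM x)

/-- The convex cutoff `(1 - x/ε)₊³` of `[0, ε]`. The exponent `3` makes it `C²`. -/
def bump (ε x : ℝ) : ℝ := max (1 - x / ε) 0 ^ 3

theorem bump_nonneg (ε x : ℝ) : 0 ≤ bump ε x := pow_nonneg (le_max_right _ _) 3

theorem bump_le_one {ε x : ℝ} (hε : 0 ≤ ε) (hx : 0 ≤ x) : bump ε x ≤ 1 :=
  pow_le_one₀ (le_max_right _ _) (max_le (sub_le_self 1 (div_nonneg hx hε)) zero_le_one)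

theorem bump_eq_zero {ε x : ℝ} (hε : 0 < ε) (hx : ε ≤ x) : bump ε x = 0 := by
  rw [bump, max_eq_right (sub_nonpos.2 ((one_le_div hε).2 hx)), zero_pow three_ne_zero]

theorem bump_mono {ε δ x : ℝ} (hε : 0 < ε) (h : ε ≤ δ) (hx : 0 ≤ x) : bump ε x ≤ bump δ x := by
  unfold bump
  gcongr

theorem convexOn_bump (ε : ℝ) : ConvexOn ℝ univ (bump ε) := by
  have haffine : ConvexOn ℝ univ fun x : ℝ => 1 - x / ε :=
    ⟨convex_univ, fun x _ y _ a b _ _ hab => le_of_eq <| by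
      simp only [smul_eq_mul]
      linear_combination -hab⟩
  exact (haffine.sup (convexOn_const 0 convex_univ)).pow (fun _ _ => le_max_right _ _) 3

theorem bump_mem_testFunctions {ε : ℝ} (hε : 0 < ε) : bump ε ∈ testFunctions := by
  let θ : ContDiffBump (0 : ℝ) := ⟨ε, ε + 1, hε, by linarith⟩
  have hbump : ContDiff ℝ 2 (bump ε) :=
    (contDiff_max_zero_pow 2).comp (contDiff_const.sub (contDiff_id.div_const ε))
  refine ⟨fun x => θ x * bump ε x, θ.contDiff.mul hbump, θ.hasCompactSupport.mul_right,
    fun x hx => ?_⟩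
  rw [mem_Ici] at hx
  rcases le_total x ε with hxε | hxε
  · have : θ x = 1 := θ.one_of_mem_closedBall (by simpa [θ, abs_of_nonneg hx] using hxε)
    simp only [this, one_mul]
  · simp only [bump_eq_zero hε hxε, mul_zero]

theorem cube_le_bump_second_difference {ε c h : ℝ} (hε : 0 < ε) (hc : c ≤ ε) (hh : 0 ≤ h) :
    (h / ε) ^ 3 ≤ bump ε (c + h) + bump ε (c - h) - 2 * bump ε c := by
  unfold bump
  rw [show 1 - (c + h) / ε = (1 - c / ε) - h / ε by ring,
    show 1 - (c - h) / ε = (1 - c / ε) + h / ε by ring]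
  have hu : 0 ≤ 1 - c / ε := sub_nonneg.2 ((div_le_one hε).2 hc)
  have hk : 0 ≤ h / ε := by positivity
  generalize 1 - c / ε = u at hu ⊢
  generalize h / ε = k at hk ⊢
  rw [max_eq_left hu, max_eq_left (add_nonneg hu hk)]
  rcases le_total u k with huk | huk
  · rw [max_eq_right (sub_nonpos.2 huk)]
    nlinarith [mul_nonneg (mul_nonneg hu hu) (sub_nonneg.2 huk), mul_nonneg (mul_nonneg hu hk) hk,
      mul_nonneg (mul_nonneg hu hu) hk]
  · rw [max_eq_left (sub_nonneg.2 huk)]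
    nlinarith [mul_nonneg (mul_nonneg hk hk) (sub_nonneg.2 huk), pow_nonneg hk 3]

theorem collisionKernel_nonneg (a b c : ℝ) : 0 ≤ collisionKernel a b c := by
  unfold collisionKernel
  split_ifs <;> positivity

theorem collisionKernel_le {a b : ℝ} (c : ℝ) (ha : 0 ≤ a) (hb : 0 ≤ b) :
    collisionKernel a b c ≤ 1 / √(max (a * b) (max (a * c) (b * c))) := by
  unfold collisionKernel
  split_ifs with hc
  · exact le_rfl
  rw [not_le, max_lt_iff] at hc
  rcases ha.eq_or_lt with rfl | ha'
  · simp
  rcases hb.eq_or_lt with rfl | hb'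
  · simp
  have hc' : 0 < c := ha'.trans hc.1
  rw [div_le_div_iff₀ (Real.sqrt_pos.2 (by positivity)) (Real.sqrt_pos.2 (by positivity)), one_mul]
  rcases le_total (a + b - c) 0 with hd | hd
  · rw [Real.sqrt_eq_zero_of_nonpos hd, zero_mul]
    positivity
  rw [← Real.sqrt_mul hd]
  apply Real.sqrt_le_sqrt
  rcases le_total a b with hab | hab
  · rw [max_eq_right (a := a * c) (by gcongr), max_eq_right (by nlinarith [hc.1])]
    nlinarith [mul_pos hb' hc', hc.2]
  · rw [max_eq_left (a := a * c) (by gcongr), max_eq_right (by nlinarith [hc.2])]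
    nlinarith [mul_pos ha' hc', hc.1]

theorem collisionKernel_eq_zero {a b c : ℝ} (ha : 0 ≤ a) (hb : 0 ≤ b) (h : a + b - c < 0) :
    collisionKernel a b c = 0 := by
  have hc : ¬c ≤ max a b := by
    rw [not_le, max_lt_iff]
    constructor <;> linarith
  rw [collisionKernel, if_neg hc, Real.sqrt_eq_zero_of_nonpos h.le, zero_div]

theorem measurable_collisionKernel :
    Measurable fun p : ℝ × ℝ × ℝ => collisionKernel p.1 p.2.1 p.2.2 := by
  unfold collisionKernel
  exact .ite (measurableSet_le (by fun_prop) (by fun_prop)) (by fun_prop) (by fun_prop)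

theorem collisionIntegrand_congr {f ψ : ℝ → ℝ} (h : EqOn ψ f (Ici 0)) (a b c : ℝ≥0) :
    collisionIntegrand ψ a b c = collisionIntegrand f a b c := by
  unfold collisionIntegrand
  rcases lt_or_ge (a + b - c : ℝ) 0 with hd | hd
  · rw [collisionKernel_eq_zero a.coe_nonneg b.coe_nonneg hd, zero_mul, zero_mul]
  · rw [h hd, h a.coe_nonneg, h b.coe_nonneg, h c.coe_nonneg]

theorem abs_sub_mul_abs_sub_le {a b c : ℝ} (ha : 0 ≤ a) (hb : 0 ≤ b) (hc : 0 ≤ c)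
    (h : 0 ≤ a + b - c) : |a - c| * |b - c| ≤ max (a * b) (max (a * c) (b * c)) := by
  rcases le_total a c with hac | hac <;> rcases le_total b c with hbc | hbc
  · rw [abs_of_nonpos (by linarith), abs_of_nonpos (by linarith)]
    exact le_max_of_le_left (by nlinarith)
  · rw [abs_of_nonpos (by linarith), abs_of_nonneg (by linarith)]
    exact le_max_of_le_right (le_max_of_le_right (by nlinarith))
  · rw [abs_of_nonneg (by linarith), abs_of_nonpos (by linarith)]
    exact le_max_of_le_right (le_max_of_le_left (by nlinarith))
  · rw [abs_of_nonneg (by linarith), abs_of_nonneg (by linarith)]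
    exact le_max_of_le_left (by nlinarith)

theorem abs_collisionIntegrand_le {ψ : ℝ → ℝ} {L : ℝ≥0} {M : ℝ} (hψ : Differentiable ℝ ψ)
    (hL : LipschitzWith L (fderiv ℝ ψ)) (hM : ∀ x, |ψ x| ≤ M) (a b c : ℝ≥0) :
    |collisionIntegrand ψ a b c| ≤ √(L * (4 * M)) := by
  rcases lt_or_ge (a + b - c : ℝ) 0 with hd | hd
  · rw [collisionIntegrand, collisionKernel_eq_zero a.coe_nonneg b.coe_nonneg hd, zero_mul,
      abs_zero]
    positivity
  set D := ψ (a + b - c) + ψ c - ψ a - ψ b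
  set P : ℝ := max (a * b) (max (a * c) (b * c))
  have hD_increments : |D| ≤ L * P := by
    have := norm_four_point_le_of_lipschitzWith_fderiv hψ hL c (a - c) (b - c)
    rw [show (c + (a - c) + (b - c) : ℝ) = a + b - c by ring, add_sub_cancel, add_sub_cancel,
      mul_assoc] at this
    exact this.trans (by gcongr; exact abs_sub_mul_abs_sub_le a.2 b.2 c.2 hd)
  have hD_bounded : |D| ≤ 4 * M := by
    grind [abs_le.1 (hM (a + b - c)), abs_le.1 (hM a), abs_le.1 (hM b), abs_le.1 (hM c), abs_le]
  -- The geometric mean of the two bounds cancels the singularity `P ^ (-1 / 2)` of the kernel.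
  have hD_mean : |D| ≤ √(L * (4 * M)) * √P := by
    rw [← Real.sqrt_mul' _ (le_max_of_le_left (by positivity))]
    refine Real.le_sqrt_of_sq_le ?_
    calc |D| ^ 2 ≤ L * P * (4 * M) := by
          rw [sq]
          exact mul_le_mul hD_increments hD_bounded (abs_nonneg D)
            ((abs_nonneg D).trans hD_increments)
      _ = L * (4 * M) * P := by ring
  calc |collisionIntegrand ψ a b c| = collisionKernel a b c * |D| := by
        rw [collisionIntegrand, abs_mul, abs_of_nonneg (collisionKernel_nonneg _ _ _)]
    _ ≤ 1 / √P * |D| := by gcongr; exact collisionKernel_le _ a.2 b.2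
    _ ≤ √(L * (4 * M)) := by
        rw [one_div_mul_eq_div]
        exact div_le_of_le_mul₀ (Real.sqrt_nonneg _) (Real.sqrt_nonneg _) hD_mean

theorem exists_abs_collisionIntegrand_le {f : ℝ → ℝ} (hf : f ∈ testFunctions) :
    ∃ B : ℝ, ∀ a b c : ℝ≥0, |collisionIntegrand f a b c| ≤ B := by
  obtain ⟨ψ, hψ, hψc, hψf⟩ := hf
  obtain ⟨M, hM⟩ := hψc.exists_bound_of_continuous hψ.continuous
  obtain ⟨L, hL⟩ := (hψ.fderiv_right (m := 1) (by norm_num)).lipschitzWith_of_hasCompactSupport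
    (hψc.fderiv ℝ) (by simp)
  refine ⟨√(L * (4 * M)), fun a b c => ?_⟩
  rw [← collisionIntegrand_congr hψf]
  exact abs_collisionIntegrand_le (hψ.differentiable (by simp)) hL hM a b c

theorem measurable_collisionIntegrand {f : ℝ → ℝ} (hf : f ∈ testFunctions) :
    Measurable fun p : ℝ≥0 × ℝ≥0 × ℝ≥0 => collisionIntegrand f p.1 p.2.1 p.2.2 := by
  obtain ⟨ψ, hψ, -, hψf⟩ := hf
  simp_rw [← collisionIntegrand_congr hψf, collisionIntegrand]
  have hψm := hψ.continuous.measurable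
  have hcoe : Measurable fun p : ℝ≥0 × ℝ≥0 × ℝ≥0 => ((p.1 : ℝ), (p.2.1 : ℝ), (p.2.2 : ℝ)) := by
    fun_prop
  exact (measurable_collisionKernel.comp hcoe).mul (by fun_prop)

theorem integrable_collisionIntegrand {f : ℝ → ℝ} (hf : f ∈ testFunctions)
    (ν : Measure (ℝ≥0 × ℝ≥0 × ℝ≥0)) [IsFiniteMeasure ν] :
    Integrable (fun p : ℝ≥0 × ℝ≥0 × ℝ≥0 => collisionIntegrand f p.1 p.2.1 p.2.2) ν := by
  obtain ⟨B, hB⟩ := exists_abs_collisionIntegrand_le hf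
  exact .of_bound (measurable_collisionIntegrand hf).aestronglyMeasurable B
    (.of_forall fun p => hB p.1 p.2.1 p.2.2)

theorem collision_congr {f ψ : ℝ → ℝ} (h : EqOn ψ f (Ici 0)) (μ : Measure ℝ≥0) :
    collision ψ μ = collision f μ :=
  integral_congr_ae (.of_forall fun p => collisionIntegrand_congr h p.1 p.2.1 p.2.2)

theorem exists_abs_collision_le {f : ℝ → ℝ} (hf : f ∈ testFunctions) :
    ∃ B : ℝ, ∀ (μ : Measure ℝ≥0) [IsFiniteMeasure μ], |collision f μ| ≤ B * μ.real univ ^ 3 := by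
  obtain ⟨B, hB⟩ := exists_abs_collisionIntegrand_le hf
  refine ⟨B, fun μ _ => ?_⟩
  calc |collision f μ| ≤ B * (μ.prod (μ.prod μ)).real univ :=
        norm_integral_le_of_norm_le_const
          (f := fun p : ℝ≥0 × ℝ≥0 × ℝ≥0 => collisionIntegrand f p.1 p.2.1 p.2.2)
          (.of_forall fun p => hB p.1 p.2.1 p.2.2)
    _ = B * μ.real univ ^ 3 := by
        rw [← univ_prod_univ, measureReal_prod_prod, ← univ_prod_univ, measureReal_prod_prod]
        ring

theorem collision_sum_smul {ι : Type*} {s : Finset ι} {c : ι → ℝ} {f : ι → ℝ → ℝ}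
    (hf : ∀ i ∈ s, f i ∈ testFunctions) (μ : Measure ℝ≥0) [IsFiniteMeasure μ] :
    collision (∑ i ∈ s, c i • f i) μ = ∑ i ∈ s, c i * collision (f i) μ := by
  unfold collision
  simp_rw [← integral_const_mul]
  rw [← integral_finsetSum s fun i hi => (integrable_collisionIntegrand (hf i hi) _).const_mul _]
  congr 1 with p
  simp only [collisionIntegrand, Finset.sum_apply, Pi.smul_apply, smul_eq_mul,
    ← Finset.sum_add_distrib, ← Finset.sum_sub_distrib, Finset.mul_sum]
  exact Finset.sum_congr rfl fun i _ => by ring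

theorem measure_Icc_le_rhoNorm {ρ : ℝ} (hρ : ρ ≤ 0) (μ : Measure ℝ≥0) {R : ℝ≥0} (hR : 1 < R) :
    μ (Icc (R / 2) R) ≤ rhoNorm ρ μ * ENNReal.ofReal (R ^ (1 + ρ)) := by
  have hR0 : (0 : ℝ) < R := by exact_mod_cast one_pos.trans hR
  have hweight : ((R : ℝ) ^ (1 + ρ))⁻¹ ≤ (1 + R : ℝ) ^ (-ρ) * (R : ℝ)⁻¹ := by
    rw [← Real.rpow_neg hR0.le, neg_add, Real.rpow_add hR0, Real.rpow_neg_one, mul_comm]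
    gcongr <;> linarith
  have hterm : ENNReal.ofReal ((R : ℝ) ^ (1 + ρ))⁻¹ * μ (Icc (R / 2) R) ≤ rhoNorm ρ μ :=
    calc _ ≤ ENNReal.ofReal ((1 + R : ℝ) ^ (-ρ) * (R : ℝ)⁻¹) * μ (Icc (R / 2) R) := by gcongr
      _ ≤ _ := le_iSup₂ (f := fun (R : ℝ≥0) (_ : 1 < R) =>
        ENNReal.ofReal ((1 + R : ℝ) ^ (-ρ) * (R : ℝ)⁻¹) * μ (Icc (R / 2) R)) R hR
      _ ≤ rhoNorm ρ μ := le_self_add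
  rwa [ENNReal.ofReal_inv_of_pos (by positivity), mul_comm,
    ← div_eq_mul_inv, ENNReal.div_le_iff (by positivity) ENNReal.ofReal_ne_top] at hterm

theorem Icc_union_iUnion_dyadic_Icc :
    Icc (0 : ℝ≥0) 1 ∪ ⋃ k : ℕ, Icc (2 ^ (k + 1) / 2) (2 ^ (k + 1)) = univ := by
  refine eq_univ_of_forall fun x => ?_
  rcases le_total x 1 with hx | hx
  · exact .inl ⟨zero_le, hx⟩
  · obtain ⟨k, hk, hk'⟩ := exists_nat_pow_near hx (by norm_num : (1 : ℝ≥0) < 2)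
    exact .inr (mem_iUnion.2 ⟨k, by rwa [pow_succ, mul_div_cancel_right₀ _ two_ne_zero], hk'.le⟩)

theorem measure_univ_lt_top_of_rhoNorm_lt_top {ρ : ℝ} {μ : Measure ℝ≥0} (hρ : ρ < -1)
    (h : rhoNorm ρ μ < ∞) : μ univ < ∞ := by
  set q := ENNReal.ofReal (2 ^ (1 + ρ)) with hq
  have hq1 : q < 1 := by
    rw [hq, ENNReal.ofReal_lt_one]
    exact Real.rpow_lt_one_of_one_lt_of_neg one_lt_two (by linarith)
  have hshell (k : ℕ) : μ (Icc (2 ^ (k + 1) / 2) (2 ^ (k + 1))) ≤ rhoNorm ρ μ * q ^ (k + 1) := by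
    convert measure_Icc_le_rhoNorm (by linarith) μ (one_lt_pow₀ one_lt_two k.succ_ne_zero) using 2
    rw [hq, ← ENNReal.ofReal_pow (by positivity), NNReal.coe_pow, NNReal.coe_ofNat,
      ← Real.rpow_natCast, ← Real.rpow_natCast, ← Real.rpow_mul zero_le_two,
      ← Real.rpow_mul zero_le_two, mul_comm]
  have hsum : ∑' k : ℕ, rhoNorm ρ μ * q ^ (k + 1) < ∞ := by
    simp_rw [ENNReal.tsum_mul_left, pow_succ, ENNReal.tsum_mul_right, ENNReal.tsum_geometric]
    exact ENNReal.mul_lt_top h (ENNReal.mul_lt_top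
      (ENNReal.inv_lt_top.2 (tsub_pos_of_lt hq1)) ENNReal.ofReal_lt_top)
  calc μ univ ≤ μ (Icc 0 1) + ∑' k : ℕ, μ (Icc (2 ^ (k + 1) / 2) (2 ^ (k + 1))) := by
        rw [← Icc_union_iUnion_dyadic_Icc]
        exact (measure_union_le _ _).trans (by gcongr; exact measure_iUnion_le _)
    _ ≤ rhoNorm ρ μ + ∑' k : ℕ, rhoNorm ρ μ * q ^ (k + 1) :=
        add_le_add le_add_self (ENNReal.tsum_le_tsum hshell)
    _ < ∞ := ENNReal.add_lt_top.2 ⟨h, hsum⟩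

section MeasurableFamily

variable {α X : Type*} [MeasurableSpace α] [MetricSpace X] [ProperSpace X] [MeasurableSpace X]
  [BorelSpace X] {μ : α → Measure X} [∀ a, IsFiniteMeasure (μ a)]

theorem measurable_measure_of_isCompact
    (h : ∀ ψ : X → ℝ, Continuous ψ → HasCompactSupport ψ → Measurable fun a => ∫ x, ψ x ∂(μ a))
    {K : Set X} (hK : IsCompact K) : Measurable fun a => μ a K := by
  have hδ (n : ℕ) : (0 : ℝ) < 1 / (n + 1) := Nat.one_div_pos_of_nat
  have hsupport (n : ℕ) : HasCompactSupport fun x => (thickenedIndicator (hδ n) K x : ℝ) :=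
    .intro' (hK.cthickening (r := 1 / (n + 1))) Metric.isClosed_cthickening fun x hx => by
      rw [thickenedIndicator_zero _ _ fun hx' => hx (Metric.thickening_subset_cthickening _ _ hx'),
        NNReal.coe_zero]
  have hreal : Measurable fun a => (μ a).real K :=
    measurable_of_tendsto_metrizable
      (fun n => h _ (NNReal.continuous_coe.comp (thickenedIndicator (hδ n) K).continuous)
        (hsupport n))
      (tendsto_pi_nhds.2 fun a => tendsto_integral_thickenedIndicator_of_isClosed (μ a)
        hK.isClosed hδ tendsto_one_div_add_atTop_nhds_zero_nat)
  simpa using hreal.ennreal_ofReal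

theorem measurable_of_forall_measurable_integral
    (h : ∀ ψ : X → ℝ, Continuous ψ → HasCompactSupport ψ → Measurable fun a => ∫ x, ψ x ∂(μ a)) :
    Measurable μ := by
  have hclosed (F : Set X) (hF : IsClosed F) : Measurable fun a => μ a F := by
    have hmono : Monotone fun n => F ∩ compactCovering X n := fun _ _ hmn =>
      inter_subset_inter_right F (compactCovering_subset X hmn)
    have hF_eq : F = ⋃ n, F ∩ compactCovering X n := by
      rw [← inter_iUnion, iUnion_compactCovering, inter_univ]
    rw [hF_eq]
    simp_rw [hmono.measure_iUnion]
    exact .iSup fun n => measurable_measure_of_isCompact h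
      ((isCompact_compactCovering X n).inter_left hF)
  exact .measure_of_isPiSystem
    (by rw [BorelSpace.measurable_eq (α := X), borel_eq_generateFrom_isClosed])
    isPiSystem_isClosed hclosed (hclosed univ isClosed_univ)

end MeasurableFamily

/-- The total mass is bounded on bounded time intervals, so that collision integrals are finite
and locally integrable in time. -/
def HasLocallyBoundedMass (g : ℝ → Measure ℝ≥0) : Prop :=
  ∀ T : ℝ, ∃ M : ℝ≥0, ∀ t ∈ Icc 0 T, g t univ ≤ M

theorem HasLocallyBoundedMass.isFiniteMeasure {g : ℝ → Measure ℝ≥0} (hg : HasLocallyBoundedMass g)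
    {t : ℝ} (ht : 0 ≤ t) : IsFiniteMeasure (g t) := by
  obtain ⟨M, hM⟩ := hg t
  exact ⟨(hM t ⟨ht, le_rfl⟩).trans_lt ENNReal.coe_lt_top⟩

theorem ConservesMassEnergy.hasLocallyBoundedMass {ρ : ℝ} {g₀ : Measure ℝ≥0}
    {g : ℝ → Measure ℝ≥0} (hg : ConservesMassEnergy g₀ g) (h₀ : g 0 = g₀) (hρ : ρ < -1)
    (hg₀ : rhoNorm ρ g₀ < ∞) : HasLocallyBoundedMass g := by
  refine fun T => ⟨(g₀ univ).toNNReal, fun t ht => ?_⟩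
  rw [ENNReal.coe_toNNReal (measure_univ_lt_top_of_rhoNorm_lt_top hρ hg₀).ne]
  rcases ht.1.eq_or_lt with rfl | ht0
  · rw [h₀]
  · exact (hg.mass t ht0).le

theorem exists_contDiff_hasCompactSupport_eventuallyEq_one (s t : ℝ) :
    ∃ θ : ℝ → ℝ, ContDiff ℝ 2 θ ∧ HasCompactSupport θ ∧ ∀ τ ∈ Icc s t, θ =ᶠ[𝓝 τ] 1 := by
  rcases le_or_gt s t with hst | hts
  · let θ : ContDiffBump ((s + t) / 2) :=
      ⟨(t - s) / 2 + 1, (t - s) / 2 + 2, by linarith, by linarith⟩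
    refine ⟨θ, θ.contDiff, θ.hasCompactSupport, fun τ hτ => ?_⟩
    refine θ.eventuallyEq_one_of_mem_ball ?_
    rw [Metric.mem_ball, Real.dist_eq, abs_lt]
    constructor <;> simp only [θ] <;> linarith [hτ.1, hτ.2]
  · exact ⟨0, contDiff_const, .zero, by simp [Icc_eq_empty_of_lt hts]⟩

namespace IsWeakSolution

variable {ρ : ℝ} {g₀ : Measure ℝ≥0} {g : ℝ → Measure ℝ≥0} {f : ℝ → ℝ}

theorem integral_sub_initial_of_contDiff (hsol : IsWeakSolution ρ g₀ g) {ψ : ℝ → ℝ}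
    (hψ : ContDiff ℝ 2 ψ) (hψc : HasCompactSupport ψ) {T : ℝ} (hT : 0 < T) :
    ∫ ω : ℝ≥0, ψ ω ∂(g T) - ∫ ω : ℝ≥0, ψ ω ∂(g 0) = ∫ t in (0 : ℝ)..T, collision ψ (g t) := by
  obtain ⟨θ, hθ, hθc, hθ1⟩ := exists_contDiff_hasCompactSupport_eventuallyEq_one 0 T
  have hθ_eq : ∀ t ∈ Icc 0 T, θ t = 1 := fun t ht => (hθ1 t ht).self_of_nhds
  have hsupport : HasCompactSupport (Function.uncurry fun t ω => θ t * ψ ω) := by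
    refine .of_support_subset_isCompact (hθc.isCompact.prod hψc.isCompact) fun p hp => ?_
    exact ⟨subset_tsupport _ (left_ne_zero_of_mul hp), subset_tsupport _ (right_ne_zero_of_mul hp)⟩
  have hderiv : ∀ t ∈ uIcc 0 T, ∫ ω : ℝ≥0, deriv (fun s => θ s * ψ ω) t ∂(g t) = 0 := by
    intro t ht
    rw [uIcc_of_le hT.le] at ht
    refine integral_eq_zero_of_ae (.of_forall fun ω => ?_)
    have : (fun s => θ s * ψ ω) =ᶠ[𝓝 t] fun _ => ψ ω :=
      (hθ1 t ht).mono fun s hs => by simp only [hs, Pi.one_apply, one_mul]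
    exact this.deriv_eq.trans (deriv_const t _)
  have hcollision : ∀ t ∈ uIcc 0 T, collision (fun ω => θ t * ψ ω) (g t) = collision ψ (g t) := by
    intro t ht
    rw [uIcc_of_le hT.le] at ht
    simp only [hθ_eq t ht, one_mul]
  have key := hsol.weak_eq (fun t ω => θ t * ψ ω)
    ((hθ.comp contDiff_fst).mul (hψ.comp contDiff_snd)) hsupport T hT
  rw [intervalIntegral.integral_congr hderiv, intervalIntegral.integral_zero, zero_add,
    intervalIntegral.integral_congr hcollision, ← hsol.initial] at key
  simpa only [hθ_eq 0 ⟨le_rfl, hT.le⟩, hθ_eq T ⟨hT.le, le_rfl⟩, one_mul] using key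

theorem integral_sub_initial (hsol : IsWeakSolution ρ g₀ g) (hf : f ∈ testFunctions) {T : ℝ}
    (hT : 0 ≤ T) :
    ∫ ω : ℝ≥0, f ω ∂(g T) - ∫ ω : ℝ≥0, f ω ∂(g 0) = ∫ t in (0 : ℝ)..T, collision f (g t) := by
  rcases hT.eq_or_lt with rfl | hT
  · simp
  obtain ⟨ψ, hψ, hψc, hψf⟩ := hf
  simp_rw [← collision_congr hψf, ← fun ω : ℝ≥0 => hψf (mem_Ici.2 ω.coe_nonneg)]
  exact hsol.integral_sub_initial_of_contDiff hψ hψc hT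

theorem measurable_restrict_Icc (hsol : IsWeakSolution ρ g₀ g) (hg : HasLocallyBoundedMass g)
    (T : ℝ) : Measurable fun t : Icc 0 T => g t := by
  have (t : Icc 0 T) : IsFiniteMeasure (g t) := hg.isFiniteMeasure t.2.1
  exact measurable_of_forall_measurable_integral fun ψ hψ hψc =>
    ((hsol.continuousOn ψ hψ hψc).comp_continuous continuous_subtype_val fun t => t.2.1).measurable

theorem measurable_collision_restrict_Icc (hsol : IsWeakSolution ρ g₀ g)
    (hg : HasLocallyBoundedMass g) (hf : f ∈ testFunctions) (T : ℝ) :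
    Measurable fun t : Icc 0 T => collision f (g t) := by
  let κ : ProbabilityTheory.Kernel (Icc 0 T) ℝ≥0 :=
    ⟨fun t => g t, hsol.measurable_restrict_Icc hg T⟩
  obtain ⟨M, hM⟩ := hg T
  have : ProbabilityTheory.IsFiniteKernel κ := ⟨⟨M, ENNReal.coe_lt_top, fun t => hM t t.2⟩⟩
  have hmeas := ((measurable_collisionIntegrand hf).stronglyMeasurable.integral_kernel
    (κ := κ.prod (κ.prod κ))).measurable
  simp_rw [ProbabilityTheory.Kernel.prod_apply] at hmeas
  exact hmeas

theorem integrableOn_collision (hsol : IsWeakSolution ρ g₀ g) (hg : HasLocallyBoundedMass g)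
    (hf : f ∈ testFunctions) (T : ℝ) :
    IntegrableOn (fun t => collision f (g t)) (Icc 0 T) := by
  obtain ⟨M, hM⟩ := hg T
  obtain ⟨B, hB⟩ := exists_abs_collision_le hf
  have hmeas : AEMeasurable (fun t => collision f (g t)) (volume.restrict (Icc 0 T)) :=
    aemeasurable_restrict_of_measurable_subtype measurableSet_Icc
      (hsol.measurable_collision_restrict_Icc hg hf T)
  refine Integrable.of_bound hmeas.aestronglyMeasurable (|B| * M ^ 3)
    (ae_restrict_of_forall_mem measurableSet_Icc fun t ht => ?_)
  have := hg.isFiniteMeasure ht.1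
  have hmass : (g t).real univ ≤ M := ENNReal.toReal_le_coe_of_le_coe (hM t ht)
  calc |collision f (g t)| ≤ B * (g t).real univ ^ 3 := hB (g t)
    _ ≤ |B| * M ^ 3 := by gcongr; exact le_abs_self B

theorem intervalIntegrable_collision (hsol : IsWeakSolution ρ g₀ g) (hg : HasLocallyBoundedMass g)
    (hf : f ∈ testFunctions) {s t : ℝ} (hs : 0 ≤ s) (ht : 0 ≤ t) :
    IntervalIntegrable (fun τ => collision f (g τ)) volume s t :=
  ((hsol.integrableOn_collision hg hf (max s t)).mono_set
    (Icc_subset_Icc_left (le_min hs ht))).intervalIntegrable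

theorem integral_sub (hsol : IsWeakSolution ρ g₀ g) (hg : HasLocallyBoundedMass g)
    (hf : f ∈ testFunctions) {s t : ℝ} (hs : 0 ≤ s) (ht : 0 ≤ t) :
    ∫ ω : ℝ≥0, f ω ∂(g t) - ∫ ω : ℝ≥0, f ω ∂(g s) = ∫ τ in s..t, collision f (g τ) := by
  rw [← intervalIntegral.integral_interval_sub_left
    (hsol.intervalIntegrable_collision hg hf le_rfl ht)
    (hsol.intervalIntegrable_collision hg hf le_rfl hs),
    ← hsol.integral_sub_initial hf ht, ← hsol.integral_sub_initial hf hs, sub_sub_sub_cancel_right]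

theorem mul_le_integral_sub (hsol : IsWeakSolution ρ g₀ g) (hg : HasLocallyBoundedMass g)
    (hf : f ∈ testFunctions) {s t A : ℝ} (hs : 0 ≤ s) (hst : s ≤ t)
    (hA : ∀ τ ∈ Icc s t, A ≤ collision f (g τ)) :
    (t - s) * A ≤ ∫ ω : ℝ≥0, f ω ∂(g t) - ∫ ω : ℝ≥0, f ω ∂(g s) := by
  rw [hsol.integral_sub hg hf hs (hs.trans hst), ← smul_eq_mul, ← intervalIntegral.integral_const]
  exact intervalIntegral.integral_mono_on hst intervalIntegrable_const
    (hsol.intervalIntegrable_collision hg hf hs (hs.trans hst)) hA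

end IsWeakSolution

/-- The sum of the collision integrand over the three choices of the outgoing frequency. Unlike the
collision integrand itself it is nonnegative for convex `f`. -/
def symmetrizedIntegrand (f : ℝ → ℝ) (a b c : ℝ) : ℝ :=
  collisionIntegrand f a b c + collisionIntegrand f a c b + collisionIntegrand f b c a

theorem collisionIntegrand_swap (f : ℝ → ℝ) (a b c : ℝ) :
    collisionIntegrand f a b c = collisionIntegrand f b a c := by
  unfold collisionIntegrand collisionKernel
  rw [max_comm a b, mul_comm a b, max_comm (a * c), add_comm a b]
  ring

theorem symmetrizedIntegrand_swap_right (f : ℝ → ℝ) (a b c : ℝ) :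
    symmetrizedIntegrand f a b c = symmetrizedIntegrand f a c b := by
  unfold symmetrizedIntegrand
  rw [collisionIntegrand_swap f b c a]
  ring

theorem symmetrizedIntegrand_swap_left (f : ℝ → ℝ) (a b c : ℝ) :
    symmetrizedIntegrand f a b c = symmetrizedIntegrand f b a c := by
  unfold symmetrizedIntegrand
  rw [collisionIntegrand_swap f a b c]
  ring

section Convex

variable {f : ℝ → ℝ} {a b c : ℝ}

theorem collisionIntegrand_nonneg_of_le_of_le (hf : ConvexOn ℝ (Ici 0) f) (ha : 0 ≤ a)
    (hb : 0 ≤ b) (hac : a ≤ c) (hbc : b ≤ c) : 0 ≤ collisionIntegrand f a b c := by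
  rcases lt_or_ge (a + b - c) 0 with hd | hd
  · rw [collisionIntegrand, collisionKernel_eq_zero ha hb hd, zero_mul]
  have hfour := map_add_sub_add_map_le_of_convexOn hf hd (ha.trans hac)
    (Icc_subset_segment (𝕜 := ℝ) ⟨by linarith, hbc⟩)
  rw [sub_add_cancel, add_sub_cancel_right] at hfour
  exact mul_nonneg (collisionKernel_nonneg _ _ _) (by linarith)

theorem le_symmetrizedIntegrand (hf : ConvexOn ℝ (Ici 0) f) (ha : 0 ≤ a) (hab : a ≤ b)
    (hbc : b ≤ c) :
    1 / √(b * c) * (f (c + (b - a)) + f (c - (b - a)) - 2 * f c) ≤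
      symmetrizedIntegrand f a b c := by
  have hb := ha.trans hab
  have hac := hab.trans hbc
  have hkernel_bca : collisionKernel b c a = 1 / √(b * c) := by
    rw [collisionKernel, if_pos (hac.trans (le_max_right _ _)),
      max_eq_left (max_le (by nlinarith) (by nlinarith))]
  have hkernel_acb : collisionKernel a c b = 1 / √(b * c) := by
    rw [collisionKernel, if_pos (hbc.trans (le_max_right _ _)),
      max_eq_right (a := a * b) (by nlinarith), max_eq_right (by nlinarith), mul_comm]
  -- When the outgoing frequency is not the largest, both kernels agree and the differences of `f`
  -- combine into a second difference at `c`; the remaining term is nonnegative.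
  have hsum : collisionIntegrand f a c b + collisionIntegrand f b c a =
      1 / √(b * c) * (f (c + (b - a)) + f (c - (b - a)) - 2 * f c) := by
    rw [collisionIntegrand, collisionIntegrand, hkernel_bca, hkernel_acb,
      show a + c - b = c - (b - a) by ring, show b + c - a = c + (b - a) by ring]
    ring
  have habc := collisionIntegrand_nonneg_of_le_of_le hf ha hb hac hbc
  unfold symmetrizedIntegrand
  linarith

theorem symmetrizedIntegrand_nonneg_of_le_of_le (hf : ConvexOn ℝ (Ici 0) f) (ha : 0 ≤ a)
    (hab : a ≤ b) (hbc : b ≤ c) : 0 ≤ symmetrizedIntegrand f a b c := by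
  refine le_trans (mul_nonneg (by positivity) ?_) (le_symmetrizedIntegrand hf ha hab hbc)
  have hfour := map_add_sub_add_map_le_of_convexOn hf
    (x := c - (b - a)) (y := c) (z := c + (b - a)) (mem_Ici.2 (by linarith))
    (mem_Ici.2 (by linarith)) (Icc_subset_segment (𝕜 := ℝ) ⟨by linarith, by linarith⟩)
  rw [show c - (b - a) + (c + (b - a)) - c = c by ring] at hfour
  linarith

theorem symmetrizedIntegrand_nonneg (hf : ConvexOn ℝ (Ici 0) f) (ha : 0 ≤ a) (hb : 0 ≤ b)
    (hc : 0 ≤ c) : 0 ≤ symmetrizedIntegrand f a b c := by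
  wlog hab : a ≤ b generalizing a b
  · rw [symmetrizedIntegrand_swap_left]
    exact this hb ha (le_of_not_ge hab)
  rcases le_total b c with hbc | hcb
  · exact symmetrizedIntegrand_nonneg_of_le_of_le hf ha hab hbc
  rw [symmetrizedIntegrand_swap_right]
  rcases le_total a c with hac | hca
  · exact symmetrizedIntegrand_nonneg_of_le_of_le hf ha hac hcb
  · rw [symmetrizedIntegrand_swap_left]
    exact symmetrizedIntegrand_nonneg_of_le_of_le hf hc hca hab

end Convex

theorem convexOn_Ici_bump (ε : ℝ) : ConvexOn ℝ (Ici 0) (bump ε) :=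
  (convexOn_bump ε).subset (subset_univ _) (convex_Ici 0)

theorem le_symmetrizedIntegrand_bump {r a b c : ℝ} (hr : 0 < r) (ha : a ∈ Icc 0 (r / 8))
    (hb : b ∈ Ioc (r / 4) r) (hc : c ∈ Ioc (r / 4) r) :
    1 / (512 * r) ≤ symmetrizedIntegrand (bump r) a b c := by
  wlog hbc : b ≤ c generalizing b c
  · rw [symmetrizedIntegrand_swap_right]
    exact this hc hb (le_of_not_ge hbc)
  obtain ⟨⟨ha₀, ha₁⟩, ⟨hb₀, hb₁⟩, -, hc₁⟩ := And.intro ha (And.intro hb hc)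
  have hkernel : 1 / r ≤ 1 / √(b * c) := by
    have : 0 < b * c := mul_pos (by linarith) (by linarith)
    gcongr
    rw [Real.sqrt_le_left hr.le]
    nlinarith
  have hgap : 1 / 8 ≤ (b - a) / r := by
    rw [le_div_iff₀ hr]
    linarith
  calc 1 / (512 * r) = 1 / r * (1 / 8) ^ 3 := by field_simp; norm_num
    _ ≤ 1 / √(b * c) * ((b - a) / r) ^ 3 := by gcongr
    _ ≤ 1 / √(b * c) * (bump r (c + (b - a)) + bump r (c - (b - a)) - 2 * bump r c) := by
        gcongr
        exact cube_le_bump_second_difference hr hc₁ (by linarith)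
    _ ≤ symmetrizedIntegrand (bump r) a b c :=
        le_symmetrizedIntegrand (convexOn_Ici_bump r) ha₀ (by linarith) hbc

section TripleProduct

variable {α : Type*} [MeasurableSpace α] (μ : Measure α) [SFinite μ]

theorem measurePreserving_swap_right :
    MeasurePreserving (fun p : α × α × α => (p.1, p.2.2, p.2.1))
      (μ.prod (μ.prod μ)) (μ.prod (μ.prod μ)) :=
  (MeasurePreserving.id μ).prod (Measure.measurePreserving_swap (μ := μ) (ν := μ))

theorem measurePreserving_rotate :
    MeasurePreserving (fun p : α × α × α => (p.2.1, p.2.2, p.1))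
      (μ.prod (μ.prod μ)) (μ.prod (μ.prod μ)) :=
  (measurePreserving_prodAssoc μ μ μ).comp
    (Measure.measurePreserving_swap (μ := μ) (ν := μ.prod μ))

end TripleProduct

theorem integral_collisionIntegrand_comp {f : ℝ → ℝ} (μ : Measure ℝ≥0)
    (hf : f ∈ testFunctions) {e : ℝ≥0 × ℝ≥0 × ℝ≥0 → ℝ≥0 × ℝ≥0 × ℝ≥0}
    (he : MeasurePreserving e (μ.prod (μ.prod μ)) (μ.prod (μ.prod μ))) :
    ∫ p, collisionIntegrand f (e p).1 (e p).2.1 (e p).2.2 ∂(μ.prod (μ.prod μ)) =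
      collision f μ := by
  rw [collision]
  conv_rhs => rw [← he.map_eq]
  rw [integral_map he.aemeasurable (measurable_collisionIntegrand hf).aestronglyMeasurable]

section FiniteMeasure

variable {f : ℝ → ℝ} (μ : Measure ℝ≥0) [IsFiniteMeasure μ]

theorem integrable_symmetrizedIntegrand (hf : f ∈ testFunctions) :
    Integrable (fun p : ℝ≥0 × ℝ≥0 × ℝ≥0 => symmetrizedIntegrand f p.1 p.2.1 p.2.2)
      (μ.prod (μ.prod μ)) := by
  have hint := integrable_collisionIntegrand hf (μ.prod (μ.prod μ))
  exact (hint.add ((measurePreserving_swap_right μ).integrable_comp_of_integrable hint)).add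
    ((measurePreserving_rotate μ).integrable_comp_of_integrable hint)

theorem integral_symmetrizedIntegrand (hf : f ∈ testFunctions) :
    ∫ p : ℝ≥0 × ℝ≥0 × ℝ≥0, symmetrizedIntegrand f p.1 p.2.1 p.2.2 ∂(μ.prod (μ.prod μ)) =
      3 * collision f μ := by
  have hint := integrable_collisionIntegrand hf (μ.prod (μ.prod μ))
  have hswap : Integrable (fun p : ℝ≥0 × ℝ≥0 × ℝ≥0 => collisionIntegrand f p.1 p.2.2 p.2.1)
      (μ.prod (μ.prod μ)) := (measurePreserving_swap_right μ).integrable_comp_of_integrable hint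
  have hrotate : Integrable (fun p : ℝ≥0 × ℝ≥0 × ℝ≥0 => collisionIntegrand f p.2.1 p.2.2 p.1)
      (μ.prod (μ.prod μ)) := (measurePreserving_rotate μ).integrable_comp_of_integrable hint
  unfold symmetrizedIntegrand
  rw [integral_add (by exact hint.add hswap) hrotate, integral_add hint hswap,
    integral_collisionIntegrand_comp μ hf (measurePreserving_swap_right μ),
    integral_collisionIntegrand_comp μ hf (measurePreserving_rotate μ), ← collision]
  ring

theorem collision_nonneg (hf : f ∈ testFunctions) (hconv : ConvexOn ℝ (Ici 0) f) :
    0 ≤ collision f μ := by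
  refine nonneg_of_mul_nonneg_right (a := 3) ?_ three_pos
  rw [← integral_symmetrizedIntegrand μ hf]
  exact integral_nonneg fun p =>
    symmetrizedIntegrand_nonneg hconv p.1.coe_nonneg p.2.1.coe_nonneg p.2.2.coe_nonneg

end FiniteMeasure

/-- The mass `μ([0, r])`. -/
def massBelow (μ : Measure ℝ≥0) (r : ℝ) : ℝ := μ.real {x : ℝ≥0 | (x : ℝ) ≤ r}

/-- A `C²` version of `massBelow`, comparable to it by `smoothMass_le_massBelow` and
`massBelow_le_smoothMass`. -/
def smoothMass (μ : Measure ℝ≥0) (r : ℝ) : ℝ := ∫ x : ℝ≥0, bump r x ∂μ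

theorem measurableSet_coe_le (r : ℝ) : MeasurableSet {x : ℝ≥0 | (x : ℝ) ≤ r} :=
  measurableSet_le (by fun_prop) (by fun_prop)

theorem massBelow_nonneg (μ : Measure ℝ≥0) (r : ℝ) : 0 ≤ massBelow μ r := measureReal_nonneg

theorem smoothMass_nonneg (μ : Measure ℝ≥0) (r : ℝ) : 0 ≤ smoothMass μ r :=
  integral_nonneg fun _ => bump_nonneg _ _

section FiniteMeasure

variable (μ : Measure ℝ≥0) [IsFiniteMeasure μ] {r : ℝ}

theorem smoothMass_mono {s : ℝ} (hr : 0 < r) (hrs : r ≤ s) : smoothMass μ r ≤ smoothMass μ s :=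
  integral_mono (integrable_of_mem_testFunctions (bump_mem_testFunctions hr) μ)
    (integrable_of_mem_testFunctions (bump_mem_testFunctions (hr.trans_le hrs)) μ)
    fun x => bump_mono hr hrs x.coe_nonneg

theorem smoothMass_le_massBelow (hr : 0 < r) : smoothMass μ r ≤ massBelow μ r := by
  have hsupport : ∫ x in {x : ℝ≥0 | (x : ℝ) ≤ r}, bump r x ∂μ = smoothMass μ r :=
    setIntegral_eq_integral_of_forall_compl_eq_zero fun x hx =>
      bump_eq_zero hr (le_of_not_ge hx)
  have hle := norm_setIntegral_le_of_norm_le_const (f := fun x : ℝ≥0 => bump r x) (C := 1)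
    (measure_lt_top μ {x : ℝ≥0 | (x : ℝ) ≤ r}) fun x _ => by
      rw [Real.norm_of_nonneg (bump_nonneg _ _)]
      exact bump_le_one hr.le x.coe_nonneg
  rw [hsupport, one_mul] at hle
  exact (le_abs_self _).trans hle

theorem massBelow_le_smoothMass (hr : 0 < r) : massBelow μ r ≤ 8 * smoothMass μ (2 * r) := by
  have hint := integrable_of_mem_testFunctions (bump_mem_testFunctions (mul_pos two_pos hr)) μ
  have hbump : ∀ x ∈ {x : ℝ≥0 | (x : ℝ) ≤ r}, (1 / 2) ^ 3 ≤ bump (2 * r) x := fun x hx => by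
    have : (x : ℝ) / (2 * r) ≤ 1 / 2 := by
      rw [div_le_div_iff₀ (by positivity) two_pos]
      linarith [show (x : ℝ) ≤ r from hx]
    exact pow_le_pow_left₀ (by norm_num) (le_max_of_le_left (by linarith)) 3
  have hmass : (1 / 2) ^ 3 * massBelow μ r ≤ smoothMass μ (2 * r) :=
    (setIntegral_ge_of_const_le_real (measurableSet_coe_le r) (measure_ne_top _ _) hbump
      hint.integrableOn).trans
    (setIntegral_le_integral hint (.of_forall fun _ => bump_nonneg _ _))
  linarith

theorem tendsto_massBelow : Tendsto (massBelow μ) (𝓝[>] 0) (𝓝 (μ.real {0})) := by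
  have hinter : ⋂ r > (0 : ℝ), {x : ℝ≥0 | (x : ℝ) ≤ r} = {0} := by
    ext x
    simp only [mem_iInter, mem_ofPred_eq, mem_singleton_iff]
    refine ⟨fun hx => ?_, fun hx r hr => by simpa [hx] using hr.le⟩
    exact NNReal.coe_eq_zero.1 ((le_of_forall_gt_imp_ge_of_dense hx).antisymm x.coe_nonneg)
  rw [← hinter]
  exact (ENNReal.tendsto_toReal (measure_ne_top _ _)).comp (tendsto_measure_biInter_gt
    (fun r _ => (measurableSet_coe_le r).nullMeasurableSet)
    (fun r s _ hrs x hx => le_trans hx hrs) ⟨1, one_pos, measure_ne_top _ _⟩)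

theorem le_collision_bump (hr : 0 < r) :
    1 / (1536 * r) * massBelow μ (r / 8) * (massBelow μ r - massBelow μ (r / 4)) ^ 2 ≤
      collision (bump r) μ := by
  have hbump := bump_mem_testFunctions hr
  set A : Set ℝ≥0 := {x | (x : ℝ) ≤ r / 8}
  set B : Set ℝ≥0 := {x | (x : ℝ) ≤ r} \ {x | (x : ℝ) ≤ r / 4}
  have hB : μ.real B = massBelow μ r - massBelow μ (r / 4) :=
    measureReal_sdiff
      (fun x hx => (show (x : ℝ) ≤ r / 4 from hx).trans (by linarith)) (measurableSet_coe_le _)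
  have hABB : MeasurableSet (A ×ˢ B ×ˢ B) :=
    have hB_meas := (measurableSet_coe_le r).diff (measurableSet_coe_le (r / 4))
    (measurableSet_coe_le _).prod (hB_meas.prod hB_meas)
  have hlower : 1 / (512 * r) * (μ.prod (μ.prod μ)).real (A ×ˢ B ×ˢ B) ≤
      3 * collision (bump r) μ := by
    rw [← integral_symmetrizedIntegrand μ hbump]
    refine (setIntegral_ge_of_const_le_real hABB (measure_ne_top _ _) ?_
      (integrable_symmetrizedIntegrand μ hbump).integrableOn).trans
      (setIntegral_le_integral (integrable_symmetrizedIntegrand μ hbump)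
        (.of_forall fun p => symmetrizedIntegrand_nonneg (convexOn_Ici_bump r) p.1.coe_nonneg
          p.2.1.coe_nonneg p.2.2.coe_nonneg))
    rintro ⟨a, b, c⟩ ⟨ha, hb, hc⟩
    exact le_symmetrizedIntegrand_bump hr ⟨a.coe_nonneg, ha⟩ ⟨not_le.1 hb.2, hb.1⟩
      ⟨not_le.1 hc.2, hc.1⟩
  rw [measureReal_prod_prod, measureReal_prod_prod, hB] at hlower
  calc 1 / (1536 * r) * massBelow μ (r / 8) * (massBelow μ r - massBelow μ (r / 4)) ^ 2
      = 1 / (512 * r) * (massBelow μ (r / 8) * ((massBelow μ r - massBelow μ (r / 4)) *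
          (massBelow μ r - massBelow μ (r / 4)))) / 3 := by ring
    _ ≤ collision (bump r) μ := by
        rw [div_le_iff₀ three_pos, mul_comm _ (3 : ℝ)]
        exact hlower

theorem mul_rpow_le_massBelow {α : ℝ} {n : ℝ≥0} (hr : 0 < r) (h : n ≤ N α μ r) :
    n * r ^ α ≤ massBelow μ r := by
  have hN : N α μ r ≤ ENNReal.ofReal (r ^ (-α) * massBelow μ r) := by
    rw [ENNReal.ofReal_mul (by positivity), massBelow, ofReal_measureReal, ← setLIntegral_one]
    unfold N
    refine mul_le_mul_right (setLIntegral_mono' (measurableSet_coe_le r) fun x hx => ?_) _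
    have hxr : (x : ℝ) / r ≤ 1 := (div_le_one hr).2 hx
    rw [ENNReal.ofReal_le_one]
    exact pow_le_one₀ (by linarith) (sub_le_self 1 (by positivity))
  have hn := (ENNReal.ofReal_coe_nnreal (p := n)).trans_le (h.trans hN)
  rwa [ENNReal.ofReal_le_ofReal_iff (mul_nonneg (by positivity) (massBelow_nonneg μ r)),
    Real.rpow_neg hr.le, inv_mul_eq_div, le_div_iff₀ (by positivity)] at hn

theorem exists_mul_rpow_le_massBelow {α : ℝ} {n u : ℝ≥0} (hn : n < lowerN α μ)
    (hu : u < upperN α μ) :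
    ∃ ε > 0, (∀ r ∈ Ioc 0 ε, n * r ^ α ≤ massBelow μ r) ∧ u * ε ^ α ≤ massBelow μ ε := by
  obtain ⟨δ, hδ, hnδ⟩ := lt_biSup_iff.1 hn
  obtain ⟨ε, hε, huε⟩ := lt_biSup_iff.1 (hu.trans_le (iInf₂_le δ hδ))
  refine ⟨ε, hε.1, fun r hr => mul_rpow_le_massBelow μ hr.1 ?_,
    mul_rpow_le_massBelow μ hε.1 huε.le⟩
  exact hnδ.le.trans (iInf₂_le r ⟨hr.1, hr.2.trans hε.2⟩)

end FiniteMeasure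

theorem geom_sum_le_inv_one_sub {q : ℝ} (hq₀ : 0 ≤ q) (hq₁ : q < 1) (K : ℕ) :
    ∑ k ∈ Finset.range K, q ^ k ≤ (1 - q)⁻¹ := by
  rw [← tsum_geometric_of_lt_one hq₀ hq₁]
  exact (summable_geometric_of_lt_one hq₀ hq₁).sum_le_tsum _ fun k _ => pow_nonneg hq₀ k

theorem sq_sum_le_mul_sum_inv_pow_mul_sq {q : ℝ} (hq₀ : 0 < q) (hq₁ : q < 1) (D : ℕ → ℝ)
    (K : ℕ) :
    (∑ k ∈ Finset.range K, D k) ^ 2 ≤ (1 - q)⁻¹ * ∑ k ∈ Finset.range K, q⁻¹ ^ k * D k ^ 2 := by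
  have hterm (k : ℕ) : 0 ≤ q⁻¹ ^ k * D k ^ 2 := by positivity
  calc (∑ k ∈ Finset.range K, D k) ^ 2
      ≤ (∑ k ∈ Finset.range K, q ^ k) * ∑ k ∈ Finset.range K, q⁻¹ ^ k * D k ^ 2 := by
        refine Finset.sum_sq_le_sum_mul_sum_of_sq_le_mul _ (fun k _ => by positivity)
          (fun k _ => hterm k) fun k _ => le_of_eq ?_
        rw [← mul_assoc, ← mul_pow, mul_inv_cancel₀ hq₀.ne', one_pow, one_mul]
    _ ≤ (1 - q)⁻¹ * ∑ k ∈ Finset.range K, q⁻¹ ^ k * D k ^ 2 := by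
        gcongr
        exact geom_sum_le_inv_one_sub hq₀.le hq₁ K

section QuadraticGrowth

variable {F : ℝ → ℝ} {A T : ℝ}

theorem two_pow_mul_le_of_quadratic_growth (hA : 0 < A)
    (hF : ∀ s t, 0 ≤ s → s ≤ t → t ≤ T → (t - s) * (A * F s ^ 2) ≤ F t - F s) (n : ℕ) :
    ∀ s, 0 ≤ s → 0 < F s → s + 2 / (A * F s) ≤ T → 2 ^ n * F s ≤ F T := by
  induction n with
  | zero =>
    intro s hs hFs hsT
    have hle : s ≤ T := le_trans (le_add_of_nonneg_right (by positivity)) hsT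
    have := hF s T hs hle le_rfl
    have : 0 ≤ (T - s) * (A * F s ^ 2) := mul_nonneg (sub_nonneg.2 hle) (by positivity)
    linarith
  | succ n ih =>
    intro s hs hFs hsT
    -- `F` doubles within time `1 / (A * F s)`, half of the time allotted to it.
    set t := s + 1 / (A * F s)
    have hstep : 0 < 1 / (A * F s) := by positivity
    have htwo : 2 / (A * F s) = 1 / (A * F s) + 1 / (A * F s) := by ring
    have hdouble : 2 * F s ≤ F t := by
      have hgrowth := hF s t hs (le_add_of_nonneg_right hstep.le) (by linarith)
      have : (t - s) * (A * F s ^ 2) = F s := by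
        rw [add_sub_cancel_left]
        field_simp
      linarith
    have hnext : 2 / (A * F t) ≤ 1 / (A * F s) := by
      rw [div_le_div_iff₀ (mul_pos hA (by linarith)) (by positivity)]
      nlinarith
    calc 2 ^ (n + 1) * F s = 2 ^ n * (2 * F s) := by ring
      _ ≤ 2 ^ n * F t := by gcongr
      _ ≤ F T := ih t (by linarith) (by linarith) (by linarith)

theorem le_two_div_of_quadratic_growth (hA : 0 < A) (hF₀ : 0 < F 0)
    (hF : ∀ s t, 0 ≤ s → s ≤ t → t ≤ T → (t - s) * (A * F s ^ 2) ≤ F t - F s) :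
    T ≤ 2 / (A * F 0) := by
  by_contra! hT
  obtain ⟨n, hn⟩ := pow_unbounded_of_one_lt (F T / F 0) one_lt_two
  have hpow := two_pow_mul_le_of_quadratic_growth hA hF n 0 le_rfl hF₀ (by linarith)
  exact ((div_lt_iff₀ hF₀).1 hn).not_ge hpow

end QuadraticGrowth

/-- The test function driving the blow-up argument: a weighted sum of bumps at the scales
`R / 4 ^ k`. The weights are summable because `2 / 3 < 1`; because `2 / 3 > 1 / 2`, they outweigh
the decay of the collision rates at small scales in `le_collision_multiscaleBump`. -/
def multiscaleBump (R : ℝ) (K : ℕ) : ℝ → ℝ :=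
  ∑ k ∈ Finset.range K, (2 / 3 : ℝ) ^ k • bump (R / 4 ^ k)

theorem multiscaleBump_mem_testFunctions {R : ℝ} (hR : 0 < R) (K : ℕ) :
    multiscaleBump R K ∈ testFunctions :=
  sum_mem fun k _ => testFunctions.smul_mem _ (bump_mem_testFunctions (by positivity))

section MultiscaleBump

variable (μ : Measure ℝ≥0) [IsFiniteMeasure μ] {R : ℝ} {K : ℕ}

theorem integral_multiscaleBump (hR : 0 < R) :
    ∫ x : ℝ≥0, multiscaleBump R K x ∂μ =
      ∑ k ∈ Finset.range K, (2 / 3 : ℝ) ^ k * smoothMass μ (R / 4 ^ k) := by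
  simp only [multiscaleBump, Finset.sum_apply, Pi.smul_apply, smul_eq_mul]
  rw [integral_finsetSum _ fun k _ => (integrable_of_mem_testFunctions
    (bump_mem_testFunctions (by positivity)) μ).const_mul _]
  simp only [integral_const_mul, smoothMass]

theorem smoothMass_le_integral_multiscaleBump (hR : 0 < R) (hK : 0 < K) :
    smoothMass μ R ≤ ∫ x : ℝ≥0, multiscaleBump R K x ∂μ := by
  rw [integral_multiscaleBump μ hR]
  simpa using Finset.single_le_sum
    (f := fun k => (2 / 3 : ℝ) ^ k * smoothMass μ (R / 4 ^ k))
    (fun k _ => mul_nonneg (by positivity) (smoothMass_nonneg _ _)) (Finset.mem_range.2 hK)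

theorem integral_multiscaleBump_le (hR : 0 < R) :
    ∫ x : ℝ≥0, multiscaleBump R K x ∂μ ≤ 3 * smoothMass μ R := by
  rw [integral_multiscaleBump μ hR]
  calc ∑ k ∈ Finset.range K, (2 / 3 : ℝ) ^ k * smoothMass μ (R / 4 ^ k)
      ≤ ∑ k ∈ Finset.range K, (2 / 3 : ℝ) ^ k * smoothMass μ R := by
        gcongr with k
        exact smoothMass_mono μ (by positivity)
          (div_le_self hR.le (one_le_pow₀ (by norm_num)))
    _ = (∑ k ∈ Finset.range K, (2 / 3 : ℝ) ^ k) * smoothMass μ R :=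
        (Finset.sum_mul _ _ _).symm
    _ ≤ (1 - 2 / 3)⁻¹ * smoothMass μ R :=
        mul_le_mul_of_nonneg_right (geom_sum_le_inv_one_sub (by norm_num) (by norm_num) K)
          (smoothMass_nonneg _ _)
    _ = 3 * smoothMass μ R := by norm_num

theorem le_collision_multiscaleBump {a : ℝ} (hR : 0 < R) (ha : 0 ≤ a)
    (hmass : ∀ k, a / 2 ^ k ≤ massBelow μ (R / 4 ^ k / 8)) :
    a / (6144 * R) * (massBelow μ R - massBelow μ (R / 4 ^ K)) ^ 2 ≤
      collision (multiscaleBump R K) μ := by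
  set D : ℕ → ℝ := fun k => massBelow μ (R / 4 ^ k) - massBelow μ (R / 4 ^ (k + 1))
  have htelescope : ∑ k ∈ Finset.range K, D k = massBelow μ R - massBelow μ (R / 4 ^ K) := by
    rw [Finset.sum_range_sub', pow_zero, div_one]
  have hscale (k : ℕ) : a / (1536 * R) * ((3 / 4 : ℝ)⁻¹ ^ k * D k ^ 2) ≤
      (2 / 3 : ℝ) ^ k * collision (bump (R / 4 ^ k)) μ := by
    have hcollision := le_collision_bump μ (r := R / 4 ^ k) (by positivity)
    rw [div_div R (4 ^ k) 4, ← pow_succ] at hcollision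
    calc a / (1536 * R) * ((3 / 4 : ℝ)⁻¹ ^ k * D k ^ 2)
        = (2 / 3 : ℝ) ^ k * (1 / (1536 * (R / 4 ^ k)) * (a / 2 ^ k) * D k ^ 2) := by
          rw [show (3 / 4 : ℝ)⁻¹ = 2 / 3 * 4 / 2 by norm_num, div_pow _ (2 : ℝ), mul_pow]
          field_simp
      _ ≤ (2 / 3 : ℝ) ^ k * (1 / (1536 * (R / 4 ^ k)) * massBelow μ (R / 4 ^ k / 8) *
            D k ^ 2) := by
          gcongr
          exact hmass k
      _ ≤ (2 / 3 : ℝ) ^ k * collision (bump (R / 4 ^ k)) μ := by gcongr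
  have hcauchy := sq_sum_le_mul_sum_inv_pow_mul_sq (q := 3 / 4) (by norm_num) (by norm_num) D K
  rw [multiscaleBump, collision_sum_smul fun k _ => bump_mem_testFunctions (by positivity)]
  calc a / (6144 * R) * (massBelow μ R - massBelow μ (R / 4 ^ K)) ^ 2
      ≤ a / (6144 * R) * ((1 - 3 / 4)⁻¹ * ∑ k ∈ Finset.range K, (3 / 4 : ℝ)⁻¹ ^ k * D k ^ 2) := by
        rw [← htelescope]
        gcongr
    _ = ∑ k ∈ Finset.range K, a / (1536 * R) * ((3 / 4 : ℝ)⁻¹ ^ k * D k ^ 2) := by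
        rw [← Finset.mul_sum]
        ring
    _ ≤ ∑ k ∈ Finset.range K, (2 / 3 : ℝ) ^ k * collision (bump (R / 4 ^ k)) μ :=
        Finset.sum_le_sum fun k _ => hscale k

end MultiscaleBump

namespace IsWeakSolution

variable {ρ : ℝ} {g₀ : Measure ℝ≥0} {g : ℝ → Measure ℝ≥0}

theorem smoothMass_le (hsol : IsWeakSolution ρ g₀ g) (hg : HasLocallyBoundedMass g) {r s t : ℝ}
    (hr : 0 < r) (hs : 0 ≤ s) (hst : s ≤ t) : smoothMass (g s) r ≤ smoothMass (g t) r := by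
  have hgrowth := hsol.mul_le_integral_sub hg (bump_mem_testFunctions hr) hs hst (A := 0)
    fun τ hτ => by
      have := hg.isFiniteMeasure (hs.trans hτ.1)
      exact collision_nonneg (g τ) (bump_mem_testFunctions hr) (convexOn_Ici_bump r)
  rwa [mul_zero, sub_nonneg] at hgrowth

theorem massBelow_le (hsol : IsWeakSolution ρ g₀ g) (hg : HasLocallyBoundedMass g) {r s t : ℝ}
    (hr : 0 < r) (hs : 0 ≤ s) (hst : s ≤ t) :
    massBelow (g s) r ≤ 8 * massBelow (g t) (2 * r) := by
  have := hg.isFiniteMeasure hs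
  have := hg.isFiniteMeasure (hs.trans hst)
  calc massBelow (g s) r ≤ 8 * smoothMass (g s) (2 * r) := massBelow_le_smoothMass (g s) hr
    _ ≤ 8 * smoothMass (g t) (2 * r) := by
        gcongr
        exact hsol.smoothMass_le hg (by positivity) hs hst
    _ ≤ 8 * massBelow (g t) (2 * r) := by
        gcongr
        exact smoothMass_le_massBelow (g t) (by positivity)

theorem exists_forall_massBelow_le (hsol : IsWeakSolution ρ g₀ g) (hg : HasLocallyBoundedMass g)
    {R T δ : ℝ} (hR : 0 < R) (hT : 0 ≤ T) (hatom : g T {0} = 0) (hδ : 0 < δ) :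
    ∃ K > 0, ∀ s ∈ Icc 0 T, massBelow (g s) (R / 4 ^ K) ≤ δ := by
  have := hg.isFiniteMeasure hT
  have hscale : Tendsto (fun K : ℕ => 2 * (R / 4 ^ K)) atTop (𝓝[>] 0) := by
    refine tendsto_nhdsWithin_iff.2 ⟨?_, .of_forall fun K => mem_Ioi.2 (by positivity)⟩
    simpa using ((tendsto_pow_atTop_atTop_of_one_lt (r := (4 : ℝ))
      (by norm_num)).const_div_atTop R).const_mul 2
  have hmass := ((tendsto_massBelow (g T)).comp hscale).const_mul 8
  rw [measureReal_def, hatom, ENNReal.toReal_zero, mul_zero] at hmass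
  obtain ⟨K, hKδ, hK⟩ := ((hmass.eventually_le_const hδ).and (eventually_gt_atTop 0)).exists
  exact ⟨K, hK, fun s hs => (hsol.massBelow_le hg (by positivity) hs.1 hs.2).trans hKδ⟩

theorem sq_integral_multiscaleBump_le_collision (hsol : IsWeakSolution ρ g₀ g)
    (hg : HasLocallyBoundedMass g) {R a s : ℝ} {K : ℕ} (hR : 0 < R) (ha : 0 ≤ a) (hK : 0 < K)
    (hs : 0 ≤ s) (hlower : ∀ k, a / 2 ^ k ≤ massBelow (g s) (R / 4 ^ k / 8))
    (hupper : massBelow (g s) (R / 4 ^ K) ≤ smoothMass (g 0) R / 6) :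
    a / (221184 * R) * (∫ x : ℝ≥0, multiscaleBump R K x ∂(g s)) ^ 2 ≤
      collision (multiscaleBump R K) (g s) := by
  have := hg.isFiniteMeasure hs
  set F := ∫ x : ℝ≥0, multiscaleBump R K x ∂(g s)
  have hF_lower : smoothMass (g 0) R ≤ F :=
    (hsol.smoothMass_le hg hR le_rfl hs).trans
      (smoothMass_le_integral_multiscaleBump (g s) hR hK)
  have hF_upper : F ≤ 3 * massBelow (g s) R :=
    (integral_multiscaleBump_le (g s) hR).trans
      (mul_le_mul_of_nonneg_left (smoothMass_le_massBelow (g s) hR) three_pos.le)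
  have hF_nonneg : 0 ≤ F := (smoothMass_nonneg _ _).trans hF_lower
  calc a / (221184 * R) * F ^ 2 = a / (6144 * R) * (F / 6) ^ 2 := by ring
    _ ≤ a / (6144 * R) * (massBelow (g s) R - massBelow (g s) (R / 4 ^ K)) ^ 2 := by
        gcongr
        linarith
    _ ≤ collision (multiscaleBump R K) (g s) := le_collision_multiscaleBump (g s) hR ha hlower

theorem le_of_massBelow_ge (hsol : IsWeakSolution ρ g₀ g) (hg : HasLocallyBoundedMass g)
    {R a T : ℝ} (hR : 0 < R) (ha : 0 < a) (hT : 0 ≤ T) (hatom : g T {0} = 0)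
    (hlower : ∀ s ∈ Icc 0 T, ∀ k, a / 2 ^ k ≤ massBelow (g s) (R / 4 ^ k / 8))
    (hpos : 0 < smoothMass (g 0) R) :
    T ≤ 442368 * R / (a * smoothMass (g 0) R) := by
  obtain ⟨K, hK, hupper⟩ :=
    hsol.exists_forall_massBelow_le hg hR hT hatom (δ := smoothMass (g 0) R / 6) (by positivity)
  have hmem := multiscaleBump_mem_testFunctions hR K
  set F : ℝ → ℝ := fun s => ∫ x : ℝ≥0, multiscaleBump R K x ∂(g s)
  set A := a / (221184 * R) with hA_def
  have hcollision : ∀ s ∈ Icc 0 T, A * F s ^ 2 ≤ collision (multiscaleBump R K) (g s) :=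
    fun s hs => hsol.sq_integral_multiscaleBump_le_collision hg hR ha.le hK hs.1 (hlower s hs)
      (hupper s hs)
  have hF_mono : ∀ s t, 0 ≤ s → s ≤ t → t ≤ T → F s ≤ F t := fun s t hs hst ht => by
    have hgrowth := hsol.mul_le_integral_sub hg hmem hs hst (A := 0) fun τ hτ =>
      le_trans (by positivity) (hcollision τ ⟨hs.trans hτ.1, hτ.2.trans ht⟩)
    rwa [mul_zero, sub_nonneg] at hgrowth
  have hF₀ : smoothMass (g 0) R ≤ F 0 :=
    have := hg.isFiniteMeasure (le_refl 0)
    smoothMass_le_integral_multiscaleBump (g 0) hR hK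
  have hF_nonneg : ∀ s, 0 ≤ s → s ≤ T → 0 ≤ F s := fun s hs hsT =>
    (hpos.le.trans hF₀).trans (hF_mono 0 s le_rfl hs hsT)
  have hT_le : T ≤ 2 / (A * F 0) := by
    refine le_two_div_of_quadratic_growth (by positivity) (hpos.trans_le hF₀)
      fun s t hs hst ht => hsol.mul_le_integral_sub hg hmem hs hst fun τ hτ => ?_
    refine le_trans ?_ (hcollision τ ⟨hs.trans hτ.1, hτ.2.trans ht⟩)
    gcongr
    · exact hF_nonneg s hs (hst.trans ht)
    · exact hF_mono s τ hs hτ.1 (hτ.2.trans ht)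
  calc T ≤ 2 / (A * F 0) := hT_le
    _ ≤ 2 / (A * smoothMass (g 0) R) := by gcongr
    _ = 442368 * R / (a * smoothMass (g 0) R) := by
        rw [hA_def]
        field_simp
        norm_num

theorem le_of_mul_sqrt_le_massBelow (hsol : IsWeakSolution ρ g₀ g) (hg : HasLocallyBoundedMass g)
    {n u ε T : ℝ} (hn : 0 < n) (hu : 0 < u) (hε : 0 < ε) (hT : 0 ≤ T) (hatom : g T {0} = 0)
    (hlower : ∀ r ∈ Ioc 0 ε, n * √r ≤ massBelow (g 0) r) (hupper : u * √ε ≤ massBelow (g 0) ε) :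
    T ≤ 226492416 / (n * u) := by
  have := hg.isFiniteMeasure (le_refl 0)
  have hsmooth : u * √ε / 8 ≤ smoothMass (g 0) (4 * ε) := by
    have := massBelow_le_smoothMass (g 0) hε
    have := smoothMass_mono (g 0) (r := 2 * ε) (s := 4 * ε) (by positivity)
      (by linarith)
    linarith
  have hmass : ∀ s ∈ Icc 0 T, ∀ k : ℕ,
      n * √ε / 16 / 2 ^ k ≤ massBelow (g s) (4 * ε / 4 ^ k / 8) := fun s hs k => by
    have hsqrt : √(ε / 4 / 4 ^ k) = √ε / 2 / 2 ^ k := by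
      rw [div_div, ← pow_succ', Real.sqrt_div hε.le, show (4 : ℝ) = 2 ^ 2 by norm_num,
        pow_right_comm, Real.sqrt_sq (by positivity), pow_succ', div_div]
    have hinitial := hlower (ε / 4 / 4 ^ k) ⟨by positivity, by
      rw [div_div]
      exact div_le_self hε.le (one_le_mul_of_one_le_of_one_le (by norm_num)
        (one_le_pow₀ (by norm_num)))⟩
    have hevolved := hsol.massBelow_le hg (r := ε / 4 / 4 ^ k) (by positivity) le_rfl hs.1
    rw [show 2 * (ε / 4 / 4 ^ k) = 4 * ε / 4 ^ k / 8 by ring] at hevolved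
    calc n * √ε / 16 / 2 ^ k = n * √(ε / 4 / 4 ^ k) / 8 := by rw [hsqrt]; ring
      _ ≤ massBelow (g s) (4 * ε / 4 ^ k / 8) := by linarith
  have hsmooth_pos : 0 < u * √ε / 8 := by positivity
  calc T ≤ 442368 * (4 * ε) / (n * √ε / 16 * smoothMass (g 0) (4 * ε)) :=
        hsol.le_of_massBelow_ge hg (by positivity) (by positivity) hT hatom hmass
          (hsmooth_pos.trans_le hsmooth)
    _ ≤ 442368 * (4 * ε) / (n * √ε / 16 * (u * √ε / 8)) := by gcongr
    _ = 442368 * (4 * ε) / (n * u * √ε ^ 2 / 128) := by ring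
    _ = 226492416 / (n * u) := by
        rw [Real.sq_sqrt hε.le]
        field_simp
        norm_num

theorem lowerN_mul_upperN_le (hsol : IsWeakSolution ρ g₀ g) (hg : HasLocallyBoundedMass g)
    {T : ℝ} (hT : 0 < T) (hatom : g T {0} = 0) :
    lowerN (1 / 2) g₀ * upperN (1 / 2) g₀ ≤ ENNReal.ofReal (226492416 / T) := by
  have := hg.isFiniteMeasure (le_refl 0)
  rw [← hsol.initial]
  refine ENNReal.mul_le_of_forall_lt fun n hn u hu => ?_
  lift n to ℝ≥0 using hn.ne_top
  lift u to ℝ≥0 using hu.ne_top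
  rcases eq_zero_or_pos n with rfl | hn_pos
  · simp
  rcases eq_zero_or_pos u with rfl | hu_pos
  · simp
  obtain ⟨ε, hε, hlower, hupper⟩ := exists_mul_rpow_le_massBelow (g 0) hn hu
  simp only [← Real.sqrt_eq_rpow] at hlower hupper
  have hT_le := hsol.le_of_mul_sqrt_le_massBelow hg (NNReal.coe_pos.2 hn_pos)
    (NNReal.coe_pos.2 hu_pos) hε hT.le hatom hlower hupper
  rw [← ENNReal.coe_mul, ← ENNReal.ofReal_coe_nnreal, NNReal.coe_mul]
  exact ENNReal.ofReal_le_ofReal ((le_div_comm₀ hT (by positivity)).1 hT_le)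

end IsWeakSolution

end

end WaveKinetic

theorem mainTheorem3_general :
    ∃ C : ℝ, 0 < C ∧
      ∀ (ρ : ℝ) (g₀ : MeasureTheory.Measure NNReal) (g : ℝ → MeasureTheory.Measure NNReal),
        WaveKinetic.IsWeakSolution ρ g₀ g →
        WaveKinetic.HasLocallyBoundedMass g →
        ∀ t : ℝ,
          ENNReal.ofReal C *
              (WaveKinetic.lowerN (1 / 2) g₀ * WaveKinetic.upperN (1 / 2) g₀)⁻¹ <
            ENNReal.ofReal t →
          0 < g t {0} := by
  refine ⟨226492416, by norm_num, fun ρ g₀ g hsol hg t ht => ?_⟩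
  have ht_pos : 0 < t := ENNReal.ofReal_pos.1 (bot_le.trans_lt ht)
  by_contra hatom
  have hproduct := hsol.lowerN_mul_upperN_le hg ht_pos (nonpos_iff_eq_zero.1 (not_lt.1 hatom))
  refine ht.not_ge ?_
  calc ENNReal.ofReal t
      = ENNReal.ofReal 226492416 * (ENNReal.ofReal (226492416 / t))⁻¹ := by
        rw [← ENNReal.ofReal_inv_of_pos (by positivity), ← ENNReal.ofReal_mul (by norm_num)]
        congr 1
        field_simp
    _ ≤ ENNReal.ofReal 226492416 *
          (WaveKinetic.lowerN (1 / 2) g₀ * WaveKinetic.upperN (1 / 2) g₀)⁻¹ := by gcongr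

theorem mainTheorem3 :
    ∃ C : ℝ, 0 < C ∧
      ∀ (ρ : ℝ) (g₀ : MeasureTheory.Measure NNReal) (g : ℝ → MeasureTheory.Measure NNReal),
        ρ < -1 →
        WaveKinetic.rhoNorm ρ g₀ < ⊤ →
        WaveKinetic.IsWeakSolution ρ g₀ g →
        WaveKinetic.ConservesMassEnergy g₀ g →
        ∀ t : ℝ,
          ENNReal.ofReal C *
              (WaveKinetic.lowerN (1 / 2) g₀ * WaveKinetic.upperN (1 / 2) g₀)⁻¹ <
            ENNReal.ofReal t →
          0 < g t {0} := by
  obtain ⟨C, hC, h⟩ := mainTheorem3_general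
  exact ⟨C, hC, fun ρ g₀ g hρ hg₀ hsol hcons =>
    h ρ g₀ g hsol (hcons.hasLocallyBoundedMass hsol.initial hρ hg₀)⟩
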